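/- Let $G$ be a finite $2$-group and let $A$ be a finite $2$-group acting on $G$ by automorphisms. For a finite group $X$ write $d(X)$ for the minimal number of generators of $X$, and let $G=\gamma_1(G)\ge\gamma_2(G)\ge\gamma_3(G)\ge\cdots$ be the lower central series, $\gamma_{n+1}(G)=[\gamma_n(G),G]$. An $A$-subgroup is a subgroup invariant under the action of $A$. A finite $2$-group $X$ on which $A$ acts by automorphisms is called $d$-maximal for $A$-subgroups if $d(H)<d(X)$ for every proper $A$-subgroup $H$ of $X$. Then the following assertions are equivalent: (i) $G$ is $d$-maximal for $A$-subgroups; (ii) $G/\gamma_3(G)$, with the induced action of $A$, is $d$-maximal for $A$-subgroups; (iii) $d(H)<d(G)$ for every proper $A$-subgroup $H$ of $G$ containing $\gamma_2(G)$. -/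

import Mathlib

/-- A subgroup `H` of `G` is an `A`-subgroup if it is invariant under the action of `A` on `G`. -/
def IsASubgroup (A : Type*) {G : Type*} [Group A] [Group G] [MulDistribMulAction A G]
    (H : Subgroup G) : Prop :=
  ∀ a : A, ∀ h ∈ H, a • h ∈ H

/-- A finite group `G` acted on by `A` is `d`-maximal for `A`-subgroups if `d(H) < d(G)` for every
proper `A`-subgroup `H` of `G`, where `d = Group.rank` is the minimal number of generators. -/
def IsDMaximal (A G : Type*) [Group A] [Group G] [Finite G] [MulDistribMulAction A G] : Prop :=
  ∀ H : Subgroup G, IsASubgroup A H → H < ⊤ → Group.rank H < Group.rank G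

/-- An action of `A` on `G` by automorphisms preserves every characteristic subgroup, so it
descends to the quotient. -/
instance quotientActionOfCharacteristic (A : Type*) {G : Type*} [Group A] [Group G]
    [MulDistribMulAction A G] (N : Subgroup G) [hN : N.Characteristic] :
    MulAction.QuotientAction A N where
  inv_mul_mem a x y hxy := by
    have h : a • (x⁻¹ * y) ∈ N := by
      have h1 := hN.fixed (MulDistribMulAction.toMulEquiv G a)
      rw [← h1] at hxy
      exact hxy
    rwa [smul_mul', smul_inv'] at h

/-- The induced action `a • (g N) = (a • g) N` on `G ⧸ N` is an action by automorphisms. -/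
instance quotientMulDistribMulAction (A : Type*) {G : Type*} [Group A] [Group G]
    [MulDistribMulAction A G] (N : Subgroup G) [N.Normal] [MulAction.QuotientAction A N] :
    MulDistribMulAction A (G ⧸ N) where
  __ := MulAction.quotient A N
  smul_mul a x y := by
    induction x using QuotientGroup.induction_on with
    | H x =>
      induction y using QuotientGroup.induction_on with
      | H y => exact congrArg (QuotientGroup.mk (s := N)) (smul_mul' a x y)
  smul_one a := congrArg (QuotientGroup.mk (s := N)) (smul_one a)

/-! Write U = γ₂(G), W = γ₃(G), and X² for the subgroup generated by the squares of X. By Burnside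
(`IsPGroup.two_pow_rank`), 2^d(X) = |X : X²|, so everything becomes an inequality of indices. As W ≤
U ≤ G², d(G/W) = d(G); ranks of subgroups can only drop in G/W, which gives (i) ⇒ (ii). The rest
hinges on whether W ≤ U².

If W ≤ U², then W ≤ H² for every H ≥ U, so d(H) = d(H/W) and (ii) ⇒ (iii). Moreover d(H) ≤ d(HU) for
every H (`IsPGroup.rank_le_rank_sup`), and HU is proper when H is because U ≤ Φ(G); so (iii) ⇒ (i).

If W is not inside U², both (ii) and (iii) fail: `IsPGroup.exists_isASubgroup_index_squares_le`
gives a proper A-subgroup C ≥ U with d(C/W) ≥ d(G), namely the centralizer of U modulo a suitable N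
in which W/N has order 2. -/

/-! ### Squares and Burnside's basis theorem. -/

section Squares

open Subgroup
open scoped commutatorElement

variable {G Q : Type*} [Group G] [Group Q]

/-- The subgroup generated by the squares of the elements of `H`. -/
def Subgroup.squares (H : Subgroup G) : Subgroup G :=
  closure ((fun x => x ^ 2) '' (H : Set G))

theorem Subgroup.sq_mem_squares {H : Subgroup G} {x : G} (hx : x ∈ H) : x ^ 2 ∈ H.squares :=
  subset_closure ⟨x, hx, rfl⟩

theorem Subgroup.squares_le {H K : Subgroup G} : H.squares ≤ K ↔ ∀ x ∈ H, x ^ 2 ∈ K := by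
  simp [squares, closure_le, Set.subset_def]

theorem Subgroup.squares_le_self (H : Subgroup G) : H.squares ≤ H :=
  squares_le.2 fun _ hx => pow_mem hx 2

theorem Subgroup.squares_mono {H K : Subgroup G} (h : H ≤ K) : H.squares ≤ K.squares :=
  squares_le.2 fun _ hx => sq_mem_squares (h hx)

theorem Subgroup.map_squares (f : G →* Q) (H : Subgroup G) :
    H.squares.map f = (H.map f).squares := by
  simp only [squares, MonoidHom.map_closure, coe_map, Set.image_image, map_pow]

instance Subgroup.squares_characteristic (H : Subgroup G) [hH : H.Characteristic] :
    H.squares.Characteristic :=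
  characteristic_iff_map_eq.2 fun φ => by
    rw [map_squares, characteristic_iff_map_eq.1 hH φ]

instance Subgroup.squares_normal (H : Subgroup G) [hH : H.Normal] : H.squares.Normal := by
  refine ⟨fun n hn g => ?_⟩
  have h : H.squares.map (MulAut.conj g).toMonoidHom ≤ H.squares := by
    rw [map_squares]
    refine squares_mono ?_
    rintro _ ⟨x, hx, rfl⟩
    exact hH.conj_mem x hx g
  exact h ⟨n, hn, rfl⟩

theorem Subgroup.commutator_self_le_squares (H : Subgroup G) : ⁅H, H⁆ ≤ H.squares := by
  rw [commutator_le]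
  intro a ha b hb
  have : ⁅a, b⁆ = (a * b) ^ 2 * (b⁻¹ * a⁻¹ * b) ^ 2 * (b⁻¹) ^ 2 := by
    simp only [commutatorElement_def, pow_two]; group
  rw [this]
  exact mul_mem (mul_mem (sq_mem_squares (mul_mem ha hb)) (sq_mem_squares
    (mul_mem (mul_mem (inv_mem hb) (inv_mem ha)) hb))) (sq_mem_squares (inv_mem hb))

theorem Subgroup.squares_subgroupOf (H : Subgroup G) :
    H.squares.subgroupOf H = (⊤ : Subgroup H).squares := by
  have h : H.squares = (⊤ : Subgroup H).squares.map H.subtype := by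
    rw [map_squares, ← MonoidHom.range_eq_map, range_subtype]
  rw [h, subgroupOf, comap_map_eq_self_of_injective H.subtype_injective]

/-- Every subgroup of a finite group has a generating set of at most `log₂` of its order. -/
theorem exists_finset_closure_eq_top_two_pow_card_le [Finite G] :
    ∃ S : Finset G, closure (S : Set G) = ⊤ ∧ 2 ^ S.card ≤ Nat.card G := by
  classical
  obtain ⟨S, hS, hmax⟩ := Set.Finite.exists_maximalFor (fun S : Finset G => closure (S : Set G))
    {S : Finset G | 2 ^ S.card ≤ Nat.card (closure (S : Set G))} (Set.toFinite _) ⟨∅, by simp⟩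
  refine ⟨S, ?_, hS.trans (card_le_card_group _)⟩
  by_contra h
  obtain ⟨x, hx⟩ : ∃ x, x ∉ closure (S : Set G) := by
    by_contra! h'
    exact h (eq_top_iff.2 fun x _ => h' x)
  have hle : closure (S : Set G) ≤ closure ((insert x S : Finset G) : Set G) :=
    closure_mono (by simp)
  have hxm : x ∈ closure ((insert x S : Finset G) : Set G) := subset_closure (by simp)
  refine hx (hmax (j := insert x S) ?_ hle hxm)
  have hne : (closure (S : Set G)).relIndex (closure ((insert x S : Finset G) : Set G)) ≠ 1 :=
    fun h1 => hx (relIndex_eq_one.1 h1 hxm)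
  have h0 : (closure (S : Set G)).relIndex (closure ((insert x S : Finset G) : Set G)) ≠ 0 :=
    (isFiniteRelIndex_of_finiteIndex).relIndex_ne_zero
  have hxS : x ∉ S := fun h => hx (subset_closure h)
  have hmul := relIndex_mul_relIndex ⊥ _ _ bot_le hle
  rw [relIndex_bot_left, relIndex_bot_left] at hmul
  change 2 ^ (insert x S).card ≤ _
  rw [Finset.card_insert_of_notMem hxS, pow_succ, ← hmul]
  exact Nat.mul_le_mul hS (by omega)

/-- A proper subgroup of a finite 2-group lies in one of twice its order, so a maximal subgroup has
index 2. -/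
theorem IsPGroup.sq_mem_of_isCoatom [Finite G] (hG : IsPGroup 2 G) {K : Subgroup G}
    (hK : IsCoatom K) (x : G) : x ^ 2 ∈ K := by
  have : Fact (Nat.Prime 2) := ⟨Nat.prime_two⟩
  obtain ⟨n, hn⟩ := IsPGroup.iff_card.1 hG
  obtain ⟨m, hm⟩ := IsPGroup.iff_card.1 (hG.to_subgroup K)
  have hlt : Nat.card K < Nat.card G := by
    refine lt_of_le_of_ne K.card_le_card_group fun h => hK.1 (eq_top_of_card_eq K h)
  have hmn : m < n := by
    rw [hn, hm] at hlt
    exact (Nat.pow_lt_pow_iff_right one_lt_two).1 hlt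
  obtain ⟨K', hK', hle⟩ := Sylow.exists_subgroup_card_pow_succ (p := 2) (n := m)
    (by rw [hn]; exact pow_dvd_pow 2 hmn) hm
  have hne : K ≠ K' := by
    rintro rfl
    rw [hm] at hK'
    exact absurd ((Nat.pow_right_injective le_rfl) hK') (by omega)
  have htop : K' = ⊤ := hK.2 _ (lt_of_le_of_ne hle hne)
  refine sq_mem_of_index_two ?_ x
  have h1 := K.card_mul_index
  rw [← card_top (G := G), ← htop, hK', hm, pow_succ] at h1
  exact Nat.eq_of_mul_eq_mul_left (by positivity) h1

theorem IsPGroup.squares_top_le_frattini [Finite G] (hG : IsPGroup 2 G) :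
    (⊤ : Subgroup G).squares ≤ frattini G := by
  rw [squares_le]
  intro x _
  simp only [frattini, Order.radical, mem_iInf]
  exact fun K hK => hG.sq_mem_of_isCoatom hK x

/-- **Burnside's basis theorem** for `2`-groups. -/
theorem IsPGroup.two_pow_rank [Finite G] (hG : IsPGroup 2 G) :
    2 ^ Group.rank G = (⊤ : Subgroup G).squares.index := by
  classical
  set N := (⊤ : Subgroup G).squares
  have hsq : ∀ x : G ⧸ N, x ^ 2 = 1 := fun x => by
    induction x using QuotientGroup.induction_on with
    | H x => exact (QuotientGroup.eq_one_iff _).2 (sq_mem_squares (mem_top x))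
  apply le_antisymm
  · obtain ⟨S, hS, hc⟩ := exists_finset_closure_eq_top_two_pow_card_le (G := G ⧸ N)
    -- Lifts of generators of G/N generate G modulo N, hence generate G, since N ≤ Φ(G).
    have hgen : closure ((S.image Quotient.out : Finset G) : Set G) ⊔ N = ⊤ := by
      have h1 : (closure ((S.image Quotient.out : Finset G) : Set G)).map
          (QuotientGroup.mk' N) = ⊤ := by
        rw [MonoidHom.map_closure, ← hS]
        congr 1
        ext x
        simp
      rw [← comap_top (QuotientGroup.mk' N), ← h1, comap_map_eq, QuotientGroup.ker_mk']
    have htop : closure ((S.image Quotient.out : Finset G) : Set G) = ⊤ :=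
      frattini_nongenerating
        (top_le_iff.1 (hgen.symm.le.trans (sup_le_sup_left hG.squares_top_le_frattini _)))
    calc 2 ^ Group.rank G ≤ 2 ^ S.card :=
          Nat.pow_le_pow_right two_pos ((Group.rank_le htop).trans Finset.card_image_le)
      _ ≤ _ := by rwa [index_eq_card]
  · let _ : CommGroup (G ⧸ N) :=
      { (inferInstance : Group (G ⧸ N)) with
        mul_comm := fun a b => by
          have hinv : ∀ x : G ⧸ N, x⁻¹ = x := fun x =>
            inv_eq_of_mul_eq_one_left (by rw [← pow_two, hsq])
          rw [← hinv (a * b), mul_inv_rev, hinv, hinv] }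
    rw [index_eq_card]
    calc Nat.card (G ⧸ N) ≤ 2 ^ Group.rank (G ⧸ N) :=
          Nat.le_of_dvd (by positivity) ((card_dvd_exponent_pow_rank (G ⧸ N)).trans
            (pow_dvd_pow_of_dvd (Monoid.exponent_dvd_of_forall_pow_eq_one hsq) _))
      _ ≤ 2 ^ Group.rank G := Nat.pow_le_pow_right two_pos
          (Group.rank_le_of_surjective (QuotientGroup.mk' N) (QuotientGroup.mk'_surjective N))

theorem IsPGroup.two_pow_rank_subgroup [Finite G] (hG : IsPGroup 2 G) (H : Subgroup G) :
    2 ^ Group.rank H = H.squares.relIndex H := by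
  rw [(hG.to_subgroup H).two_pow_rank, relIndex, squares_subgroupOf]

theorem Subgroup.comap_squares_sup_map {f : G →* Q} (hf : Function.Surjective f) (K : Subgroup Q)
    (L : Subgroup G) :
    (K.squares ⊔ L.map f).comap f = (K.comap f).squares ⊔ L ⊔ f.ker := by
  rw [← comap_map_eq, map_sup, map_squares, map_comap_eq_self_of_surjective hf]

theorem Subgroup.squares_sup_ker_relIndex {f : G →* Q} (hf : Function.Surjective f)
    (K : Subgroup Q) :
    K.squares.relIndex K = ((K.comap f).squares ⊔ f.ker).relIndex (K.comap f) := by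
  have h := comap_squares_sup_map hf K ⊥
  rw [map_bot, sup_bot_eq, sup_bot_eq] at h
  rw [← h, relIndex_comap, map_comap_eq_self_of_surjective hf]

theorem IsPGroup.two_pow_rank_map_mk [Finite G] (hG : IsPGroup 2 G) (N : Subgroup G) [N.Normal]
    (K : Subgroup (G ⧸ N)) : 2 ^ Group.rank K =
      ((K.comap (QuotientGroup.mk' N)).squares ⊔ N).relIndex (K.comap (QuotientGroup.mk' N)) := by
  have hs := QuotientGroup.mk'_surjective N
  have h := squares_sup_ker_relIndex hs K
  rw [QuotientGroup.ker_mk'] at h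
  rw [(hG.to_quotient N).two_pow_rank_subgroup, h]

theorem IsPGroup.rank_quotient_eq_rank [Finite G] (hG : IsPGroup 2 G) (N : Subgroup G) [N.Normal]
    (hN : N ≤ (⊤ : Subgroup G).squares) : Group.rank (G ⧸ N) = Group.rank G := by
  refine Nat.pow_right_injective le_rfl (?_ : 2 ^ _ = 2 ^ _)
  rw [hG.two_pow_rank, (hG.to_quotient N).two_pow_rank,
    ← index_comap_of_surjective _ (QuotientGroup.mk'_surjective N),
    ← map_top_of_surjective _ (QuotientGroup.mk'_surjective N), ← map_squares, comap_map_eq,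
    QuotientGroup.ker_mk', sup_eq_left.2 hN]

end Squares

/-! ### Adjoining subgroups of γ₂(G). -/

section

open Subgroup
open scoped commutatorElement

variable {G : Type*} [Group G]

theorem Subgroup.commutator_sup_top_le (K X : Subgroup G) [K.Normal] [X.Normal] :
    ⁅K ⊔ X, (⊤ : Subgroup G)⁆ ≤ K ⊔ ⁅X, (⊤ : Subgroup G)⁆ := by
  rw [commutator_le]
  intro y hy g _
  obtain ⟨k, hk, x, hx, rfl⟩ := mem_sup_of_normal_left.1 hy
  rw [commutatorElement_mul_left_eq_conj_mul]
  refine mul_mem ?_ (mem_sup_left ?_)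
  · exact (inferInstance : (K ⊔ ⁅X, (⊤ : Subgroup G)⁆).Normal).conj_mem _
      (mem_sup_right (commutator_mem_commutator hx (mem_top g))) _
  · exact commutator_le_left K ⊤ (commutator_mem_commutator hk (mem_top g))

/-- A Nakayama-type argument: iterating the hypothesis puts X inside Kγₙ(G) for every n. -/
theorem Subgroup.le_of_le_sup_commutator_top [Group.IsNilpotent G] {K X : Subgroup G} [K.Normal]
    [X.Normal] (h : X ≤ K ⊔ ⁅X, (⊤ : Subgroup G)⁆) : X ≤ K := by
  have key : ∀ n, X ≤ K ⊔ lowerCentralSeries (⊤ : Subgroup G) n := by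
    intro n
    induction n with
    | zero => exact le_top.trans (le_sup_right (a := K))
    | succ n ih =>
      refine h.trans (sup_le le_sup_left ?_)
      exact (commutator_mono ih le_rfl).trans (commutator_sup_top_le _ _)
  obtain ⟨n, hn⟩ := nilpotent_iff_lowerCentralSeries.1 (inferInstance : Group.IsNilpotent G)
  simpa [hn] using key n

/-- A form of the three subgroups lemma. -/
theorem Subgroup.commutator_lowerCentralSeries_one_le (S : Subgroup G) [S.Normal] :
    ⁅S, lowerCentralSeries (⊤ : Subgroup G) 1⁆ ≤ ⁅⁅S, (⊤ : Subgroup G)⁆, (⊤ : Subgroup G)⁆ := by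
  set N := ⁅⁅S, (⊤ : Subgroup G)⁆, (⊤ : Subgroup G)⁆
  have hs := map_top_of_surjective _ (QuotientGroup.mk'_surjective N)
  have h1 : ⁅⁅S.map (QuotientGroup.mk' N), (⊤ : Subgroup (G ⧸ N))⁆, (⊤ : Subgroup (G ⧸ N))⁆ = ⊥ := by
    rw [← hs, ← map_commutator, ← map_commutator, QuotientGroup.map_mk'_self]
  have h2 := commutator_commutator_eq_bot_of_rotate
    (by rwa [commutator_comm ⊤ (S.map _)]) h1
  rw [← QuotientGroup.ker_mk' N, ← map_eq_bot_iff, map_commutator,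
    commutator_comm (S.map _)]
  change ⁅map _ ⁅(⊤ : Subgroup G), ⊤⁆, _⁆ = ⊥
  rwa [map_commutator, hs]

theorem Subgroup.lowerCentralSeries_one_le_squares_top :
    lowerCentralSeries (⊤ : Subgroup G) 1 ≤ (⊤ : Subgroup G).squares :=
  commutator_self_le_squares ⊤

/-- If `T` is central modulo its squares (for `T ≤ γ₂(G)`), then so is the
subgroup of its squares. -/
theorem Subgroup.commutator_squares_top_le [Group.IsNilpotent G] {T : Subgroup G} [T.Normal]
    (hT : T ≤ Subgroup.lowerCentralSeries (⊤ : Subgroup G) 1) (h : ⁅T, (⊤ : Subgroup G)⁆ ≤ T.squares) :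
    ⁅T.squares, (⊤ : Subgroup G)⁆ ≤ T.squares.squares := by
  -- It suffices to work modulo [S, G, G], where T ≤ γ₂(G) makes S commute with T.
  apply le_of_le_sup_commutator_top
  set S := T.squares
  set M := S.squares ⊔ ⁅⁅S, (⊤ : Subgroup G)⁆, (⊤ : Subgroup G)⁆
  have hST : ⁅S, T⁆ ≤ M := ((commutator_mono le_rfl hT).trans
    (commutator_lowerCentralSeries_one_le S)).trans le_sup_right
  have hM : M.Normal := inferInstance
  have hC : S.map (QuotientGroup.mk' M) ≤ center (G ⧸ M) := by
    rw [map_le_iff_le_comap, squares_le]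
    intro t ht
    rw [mem_comap, mem_center_iff]
    intro g
    induction g using QuotientGroup.induction_on with
    | H g =>
      have hs : ⁅t, g⁆ ∈ S := h (commutator_mem_commutator ht (mem_top g))
      have e : ⁅t ^ 2, g⁆ = ⁅⁅t, g⁆, t⁆⁻¹ * ⁅t, g⁆ ^ 2 := by
        simp [commutatorElement_def, pow_two, mul_assoc]
      have : ⁅t ^ 2, g⁆ ∈ M := by
        rw [e]
        exact mul_mem (inv_mem (hST (commutator_mem_commutator hs ht)))
          (mem_sup_left (sq_mem_squares hs))
      have h1 := (QuotientGroup.eq_one_iff (N := M) _).2 this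
      have h2 : ⁅(QuotientGroup.mk' M) (t ^ 2), (QuotientGroup.mk' M) g⁆ = 1 := by
        rw [← map_commutatorElement]; exact h1
      exact (commutatorElement_eq_one_iff_mul_comm.1 h2).symm
  rw [← QuotientGroup.ker_mk' M, ← map_eq_bot_iff, map_commutator,
    map_top_of_surjective _ (QuotientGroup.mk'_surjective M)]
  exact commutator_top_right_eq_bot_iff_le_center.2 hC

/-- Modulo R the image of T is abelian, so its squares already form a subgroup. -/
theorem Subgroup.exists_sq_of_mem_squares {T R : Subgroup G} (hTT : ⁅T, T⁆ ≤ R) [R.Normal]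
    {s : G} (hs : s ∈ T.squares) : ∃ t ∈ T, (t ^ 2)⁻¹ * s ∈ R := by
  simp only [← QuotientGroup.eq]
  have hcomm : ∀ a ∈ T, ∀ b ∈ T, Commute (a : G ⧸ R) b := fun a ha b hb => by
    have h := (QuotientGroup.eq_one_iff (N := R) _).2 (hTT (commutator_mem_commutator ha hb))
    rw [← QuotientGroup.mk'_apply, map_commutatorElement] at h
    exact commutatorElement_eq_one_iff_commute.1 h
  induction hs using closure_induction with
  | mem x hx =>
    obtain ⟨t, ht, rfl⟩ := hx
    exact ⟨t, ht, rfl⟩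
  | one => exact ⟨1, one_mem T, by simp⟩
  | mul x y _ _ hx hy =>
    obtain ⟨a, ha, hax⟩ := hx
    obtain ⟨b, hb, hby⟩ := hy
    refine ⟨a * b, mul_mem ha hb, ?_⟩
    rw [QuotientGroup.mk_mul, ← hax, ← hby, QuotientGroup.mk_pow, QuotientGroup.mk_pow,
      QuotientGroup.mk_pow, QuotientGroup.mk_mul, (hcomm a ha b hb).mul_pow]
  | inv x _ hx =>
    obtain ⟨a, ha, hax⟩ := hx
    refine ⟨a⁻¹, inv_mem ha, ?_⟩
    rw [QuotientGroup.mk_inv, ← hax, ← QuotientGroup.mk_inv, inv_pow]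

/-- H need not be normal; the equality is |HK| |H ∩ K| = |H| |K|. -/
theorem Subgroup.relIndex_sup_of_normal_right [Finite G] (H K : Subgroup G) [K.Normal] :
    H.relIndex (H ⊔ K) = H.relIndex K := by
  have h1 := relIndex_mul_relIndex ⊥ H (H ⊔ K) bot_le le_sup_left
  have h2 := relIndex_mul_relIndex ⊥ K (H ⊔ K) bot_le le_sup_right
  have h3 := relIndex_mul_relIndex ⊥ (H ⊓ K) H bot_le inf_le_left
  have h4 := relIndex_mul_relIndex ⊥ (H ⊓ K) K bot_le inf_le_right
  rw [relIndex_sup_right] at h2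
  rw [inf_relIndex_left] at h3
  rw [inf_relIndex_right] at h4
  simp only [relIndex_bot_left] at h1 h2 h3 h4
  have hpos : 0 < Nat.card H := Nat.card_pos
  refine Nat.eq_of_mul_eq_mul_left hpos ?_
  rw [h1, ← h2, ← h3, ← h4]
  ring

/-- Squaring induces a well-defined surjection from T/(T ∩ H) onto T²/(T² ∩ H²). -/
theorem Subgroup.relIndex_squares_le [Finite G] {T H : Subgroup G} [T.Normal]
    (hTT : ⁅T, T⁆ ≤ T.squares.squares) (hH : T.squares ≤ H) :
    H.squares.relIndex T.squares ≤ H.relIndex T := by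
  have hSH : T.squares.squares ≤ H.squares := squares_mono hH
  let f : T ⧸ H.subgroupOf T → T.squares ⧸ H.squares.subgroupOf T.squares :=
    Quotient.map' (fun t => ⟨(t : G) ^ 2, sq_mem_squares t.2⟩) (by
      intro a b hab
      rw [QuotientGroup.leftRel_apply, mem_subgroupOf] at hab ⊢
      change ((a : G) ^ 2)⁻¹ * (b : G) ^ 2 ∈ H.squares
      have hab' : (a : G)⁻¹ * b ∈ H := hab
      have e : ((a : G) ^ 2)⁻¹ * (b : G) ^ 2
          = ⁅(a : G)⁻¹, (a : G)⁻¹ * b⁆ * ((a : G)⁻¹ * b) ^ 2 := by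
        simp only [commutatorElement_def, pow_two]; group
      rw [e]
      exact mul_mem (hSH (hTT (commutator_mem_commutator (inv_mem a.2)
        (mul_mem (inv_mem a.2) b.2)))) (sq_mem_squares hab'))
  refine Nat.card_le_card_of_surjective f fun q => ?_
  induction q using QuotientGroup.induction_on with
  | H s =>
    obtain ⟨t, ht, hts⟩ := exists_sq_of_mem_squares hTT s.2
    exact ⟨((⟨t, ht⟩ : T) : T ⧸ H.subgroupOf T), QuotientGroup.eq.2 (hSH hts)⟩

theorem IsPGroup.rank_le_rank_sup_of_squares_le [Finite G] (hG : IsPGroup 2 G) {T H : Subgroup G}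
    [T.Normal] (hT : ⁅T, (⊤ : Subgroup G)⁆ ≤ T.squares) (hTT : ⁅T, T⁆ ≤ T.squares.squares)
    (hH : T.squares ≤ H) : Group.rank H ≤ Group.rank (H ⊔ T : Subgroup G) := by
  rw [← Nat.pow_le_pow_iff_right one_lt_two, hG.two_pow_rank_subgroup, hG.two_pow_rank_subgroup]
  have hsq : (H ⊔ T).squares = H.squares ⊔ T.squares := by
    apply le_antisymm
    · rw [squares_le]
      intro x hx
      obtain ⟨h, hh, t, ht, rfl⟩ := mem_sup_of_normal_right.1 hx
      have e : (h * t) ^ 2 = h ^ 2 * (⁅h⁻¹, t⁆ * t ^ 2) := by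
        simp only [commutatorElement_def, pow_two]; group
      rw [e]
      refine mul_mem (mem_sup_left (sq_mem_squares hh)) (mem_sup_right
        (mul_mem (hT ?_) (sq_mem_squares ht)))
      rw [commutator_comm]
      exact commutator_mem_commutator (mem_top _) ht
    · exact sup_le (squares_mono le_sup_left) (squares_mono le_sup_right)
  have hle : H.squares ⊔ T.squares ≤ H := sup_le (squares_le_self H) hH
  -- Cancelling |H : H²T²| leaves |T² : T² ∩ H²| ≤ |T : T ∩ H|.
  rw [hsq, ← relIndex_mul_relIndex _ _ _ hle le_sup_left,
    ← relIndex_mul_relIndex _ _ _ (le_sup_left : H.squares ≤ H.squares ⊔ T.squares) hle, mul_comm,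
    relIndex_sup_of_normal_right, relIndex_sup_of_normal_right]
  exact Nat.mul_le_mul le_rfl (relIndex_squares_le hTT hH)

theorem IsPGroup.squares_lt_self [Finite G] (hG : IsPGroup 2 G) {T : Subgroup G} (hT : T ≠ ⊥) :
    T.squares < T := by
  refine lt_of_le_of_ne T.squares_le_self fun h => ?_
  have h1 := hG.two_pow_rank_subgroup T
  have := T.nontrivial_iff_ne_bot.2 hT
  rw [h, relIndex_self] at h1
  exact (Nat.one_lt_two_pow (Group.rank_pos (G := T)).ne').ne' h1

/-- Adjoining to a subgroup of a finite `2`-group a normal subgroup of the derived subgroup that is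
central modulo its squares does not decrease the number of generators. -/
theorem IsPGroup.rank_le_rank_sup [Finite G] (hG : IsPGroup 2 G) (T : Subgroup G) [hn : T.Normal]
    (hT : T ≤ Subgroup.lowerCentralSeries (⊤ : Subgroup G) 1) (h : ⁅T, (⊤ : Subgroup G)⁆ ≤ T.squares)
    (H : Subgroup G) : Group.rank H ≤ Group.rank (H ⊔ T : Subgroup G) := by
  have : Fact (Nat.Prime 2) := ⟨Nat.prime_two⟩
  have : Group.IsNilpotent G := hG.isNilpotent
  revert hn
  induction T using WellFoundedLT.induction generalizing H with
  | ind T ih =>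
    intro hn
    by_cases hbot : T = ⊥
    · subst hbot; rw [sup_bot_eq]
    have h2 := commutator_squares_top_le hT h
    -- Climb from H to HT² by induction, T² inheriting the hypotheses of T, then from HT² to HT.
    refine (ih _ (hG.squares_lt_self hbot) (T.squares_le_self.trans hT) h2 H).trans ?_
    refine (hG.rank_le_rank_sup_of_squares_le h ?_ le_sup_right).trans_eq ?_
    · exact (commutator_mono le_rfl hT).trans <| (commutator_lowerCentralSeries_one_le T).trans <|
        (commutator_mono h le_rfl).trans h2
    · exact Subgroup.rank_congr (by rw [sup_assoc, sup_eq_right.2 T.squares_le_self])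

end

/-! ### The centralizer of γ₂(G). -/

section

open Subgroup
open scoped commutatorElement

variable {G : Type*} [Group G]

/-- A bilinear pairing argument: if commutators with elements of `U` take at most one nontrivial
value, then the index of the centralizer of `U` is at most the index of `U ⊓ Z(G)` in `U`. -/
theorem Subgroup.index_centralizer_le_relIndex_center [Finite G] (z : G)
    (U : Subgroup G) (hU : ∀ u ∈ U, ∀ g : G, ⁅u, g⁆ = 1 ∨ ⁅u, g⁆ = z) :
    (centralizer (U : Set G)).index ≤ (center G).relIndex U := by
  induction U using WellFoundedLT.induction with
  | ind U ih =>
    by_cases hc : U ≤ center G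
    · have : centralizer (U : Set G) = ⊤ := centralizer_eq_top_iff_subset.2 hc
      rw [this, index_top, relIndex_eq_one.2 hc]
    obtain ⟨u, huU, huc⟩ := SetLike.not_le_iff_exists.1 hc
    obtain ⟨g, hg⟩ : ∃ g : G, ⁅u, g⁆ ≠ 1 := by
      by_contra! h
      exact huc (mem_center_iff.2 fun g => (commutatorElement_eq_one_iff_mul_comm.1 (h g)).symm)
    -- Induct on V: |U : V| ≥ 2, while U is generated by V and u, and u has at most two conjugates.
    set V := U ⊓ (centralizer {g} : Subgroup G)
    have hVU : V ≤ U := inf_le_left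
    have hmemV : ∀ v, v ∈ V ↔ v ∈ U ∧ ⁅v, g⁆ = 1 := fun v => by
      rw [commutatorElement_eq_one_iff_mul_comm, mem_inf, mem_centralizer_singleton_iff]
    have huV : u ∉ V := fun h => hg ((hmemV u).1 h).2
    have hcV : center G ⊓ U ≤ V := fun x hx => (hmemV x).2
      ⟨hx.2, commutatorElement_eq_one_iff_mul_comm.2 (mem_center_iff.1 hx.1 g).symm⟩
    have hV := ih V (lt_of_le_of_ne hVU fun h => huV (h ▸ huU)) fun v hv => hU v (hVU hv)
    have hrel : (center G).relIndex U = (center G).relIndex V * V.relIndex U := by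
      rw [← inf_relIndex_right (center G) U, ← relIndex_mul_relIndex _ _ _ hcV hVU,
        ← inf_relIndex_right (center G) V]
      congr 2
      exact le_antisymm (le_inf inf_le_left hcV) (inf_le_inf_left _ hVU)
    have h2 : 2 ≤ V.relIndex U := by
      have h0 : V.relIndex U ≠ 0 := (isFiniteRelIndex_of_finiteIndex).relIndex_ne_zero
      have h1 : V.relIndex U ≠ 1 := fun h => huV (relIndex_eq_one.1 h huU)
      omega
    have huz : ⁅u, g⁆ = z := (hU u huU g).resolve_left hg
    have hcent : centralizer (V : Set G) ⊓ centralizer {u} ≤ centralizer (U : Set G) := by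
      intro x hx
      obtain ⟨hxV, hxu⟩ := mem_inf.1 hx
      rw [mem_centralizer_iff] at hxV ⊢
      rw [mem_centralizer_singleton_iff] at hxu
      intro w hw
      rcases hU w hw g with h | h
      · exact hxV w ((hmemV w).2 ⟨hw, h⟩)
      · have hm : u⁻¹ * w ∈ V := by
          refine (hmemV _).2 ⟨mul_mem (inv_mem huU) hw, ?_⟩
          have h1 : w * g * w⁻¹ = u * g * u⁻¹ := mul_right_cancel (h.trans huz.symm)
          rw [commutatorElement_eq_one_iff_mul_comm]
          calc u⁻¹ * w * g = u⁻¹ * (w * g * w⁻¹) * w := by group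
            _ = g * (u⁻¹ * w) := by rw [h1]; group
        calc w * x = u * (u⁻¹ * w * x) := by group
          _ = u * x * (u⁻¹ * w) := by rw [hxV _ hm, mul_assoc]
          _ = x * w := by rw [← hxu]; group
    have hu2 : (centralizer {u} : Subgroup G).index ≤ 2 := by
      refine Nat.le_of_dvd two_pos (index_dvd_two_iff'.2 ⟨g⁻¹, fun b => ?_⟩)
      simp only [mem_centralizer_singleton_iff]
      rcases hU u huU b with h | h
      · exact Or.inr (commutatorElement_eq_one_iff_mul_comm.1 h).symm
      · left
        have h1 : u * (b * u⁻¹ * b⁻¹) = u * (g * u⁻¹ * g⁻¹) := by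
          simpa only [commutatorElement_def, mul_assoc] using h.trans huz.symm
        have h2 : b * u * b⁻¹ = g * u * g⁻¹ := by
          have := congrArg (·⁻¹) (mul_left_cancel h1)
          simpa [mul_assoc] using this
        calc g⁻¹ * b * u = g⁻¹ * (b * u * b⁻¹) * b := by group
          _ = u * (g⁻¹ * b) := by rw [h2]; group
    calc (centralizer (U : Set G)).index
        ≤ (centralizer (V : Set G) ⊓ centralizer {u}).index := index_antitone hcent
      _ ≤ (centralizer (V : Set G)).index * (centralizer {u} : Subgroup G).index := index_inf_le
      _ ≤ (center G).relIndex V * V.relIndex U := Nat.mul_le_mul hV (hu2.trans h2)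
      _ = _ := hrel.symm

/-- In a finite group whose derived subgroup has exponent `2` and whose third lower central term is
central of order `2`, the centralizer of the derived subgroup needs at least as many generators as
the group. -/
theorem Subgroup.index_squares_top_le_relIndex_centralizer [Finite G]
    (h2 : (Subgroup.lowerCentralSeries (⊤ : Subgroup G) 1).squares = ⊥)
    (h3 : Nat.card (Subgroup.lowerCentralSeries (⊤ : Subgroup G) 2) = 2)
    (h4 : Subgroup.lowerCentralSeries (⊤ : Subgroup G) 3 = ⊥) :
    centralizer (Subgroup.lowerCentralSeries (⊤ : Subgroup G) 1 : Set G) < ⊤ ∧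
    Subgroup.lowerCentralSeries (⊤ : Subgroup G) 1 ≤
      centralizer (Subgroup.lowerCentralSeries (⊤ : Subgroup G) 1 : Set G) ∧
    (⊤ : Subgroup G).squares.index ≤
      ((centralizer (Subgroup.lowerCentralSeries (⊤ : Subgroup G) 1 : Set G)).squares ⊔
        Subgroup.lowerCentralSeries (⊤ : Subgroup G) 2).relIndex
        (centralizer (Subgroup.lowerCentralSeries (⊤ : Subgroup G) 1 : Set G)) := by
  set U := Subgroup.lowerCentralSeries (⊤ : Subgroup G) 1 with hUdef
  set W := Subgroup.lowerCentralSeries (⊤ : Subgroup G) 2 with hWdef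
  have hUW : ∀ u ∈ U, ∀ g : G, ⁅u, g⁆ ∈ W := fun u hu g =>
    commutator_mem_commutator hu (mem_top g)
  have hWU : W ≤ U := Subgroup.lowerCentralSeries_antitone ⊤ one_le_two
  have hWc : W ≤ center G := commutator_top_right_eq_bot_iff_le_center.1 h4
  have hUsq : ∀ u ∈ U, u * u = 1 := fun u hu => by
    have : u ^ 2 ∈ U.squares := sq_mem_squares hu
    rwa [h2, mem_bot, pow_two] at this
  obtain ⟨z, hzW, hzeq⟩ : ∃ z ∈ W, ∀ w ∈ W, w = 1 ∨ w = z := by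
    obtain ⟨x, y, hxy, huniv⟩ := Nat.card_eq_two_iff.1 h3
    have hall : ∀ w : W, w = x ∨ w = y := fun w => by
      have : w ∈ ({x, y} : Set W) := huniv ▸ Set.mem_univ w
      simpa using this
    rcases hall 1 with h | h
    · exact ⟨y, y.2, fun w hw => (hall ⟨w, hw⟩).imp (fun e => by rw [← h] at e; exact congrArg Subtype.val e)
        (congrArg Subtype.val)⟩
    · exact ⟨x, x.2, fun w hw => (hall ⟨w, hw⟩).symm.imp
        (fun e => by rw [← h] at e; exact congrArg Subtype.val e) (congrArg Subtype.val)⟩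
  set C := centralizer (U : Set G)
  have hCU : ∀ c ∈ C, ∀ u ∈ U, u * c = c * u := fun c hc u hu => mem_centralizer_iff.1 hc u hu
  have hUC : U ≤ C := by
    rw [← commutator_eq_bot_iff_le_centralizer, eq_bot_iff, ← h4]
    exact commutator_lowerCentralSeries_one_le U |>.trans le_rfl
  have hsqC : (⊤ : Subgroup G).squares ≤ C := by
    rw [squares_le]
    intro g _
    rw [mem_centralizer_iff]
    intro u hu
    have hw := hUW u hu g
    have e : u * g ^ 2 = ⁅u, g⁆ * (g * ⁅u, g⁆ * g⁻¹) * (g ^ 2 * u) := by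
      simp [commutatorElement_def, pow_two, mul_assoc]
    rw [e, mem_center_iff.1 (hWc hw) g, mul_inv_cancel_right, hUsq _ (hWU hw), one_mul]
  have hCsq : C.squares ≤ center G := by
    rw [squares_le]
    intro c hc
    rw [mem_center_iff]
    intro g
    have hw : ⁅c, g⁆ ∈ U := commutator_mem_commutator (mem_top c) (mem_top g)
    have e : c ^ 2 * g = c * ⁅c, g⁆ * g * c := by
      simp [commutatorElement_def, pow_two, mul_assoc]
    have e2 : ⁅c, g⁆ * (c * g) = ⁅c, g⁆ * ⁅c, g⁆ * (g * c) := by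
      simp [commutatorElement_def, mul_assoc]
    rw [e, ← hCU c hc _ hw, mul_assoc _ c g, e2, hUsq _ hw, one_mul, pow_two, mul_assoc]
  refine ⟨lt_top_iff_ne_top.2 fun h => ?_, hUC, ?_⟩
  · have : W = ⊥ := commutator_eq_bot_iff_le_centralizer.2
      (show U ≤ centralizer ((⊤ : Subgroup G) : Set G) from le_centralizer_iff.1 h.ge)
    rw [this, card_bot] at h3
    exact absurd h3 (by norm_num)
  · set D := C.squares ⊔ W
    have hUsqtop : U ≤ (⊤ : Subgroup G).squares := lowerCentralSeries_one_le_squares_top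
    have hDc : D ≤ center G := sup_le hCsq hWc
    have hD : D ≤ (⊤ : Subgroup G).squares :=
      sup_le (squares_mono le_top) (hWU.trans hUsqtop)
    -- With |C : G²| cancelled, the claim is |G : C| ≤ |G² : D|.
    rw [← relIndex_mul_relIndex _ _ _ hD hsqC, ← relIndex_mul_index hsqC, mul_comm]
    refine Nat.mul_le_mul ?_ le_rfl
    calc C.index ≤ (center G).relIndex U :=
          index_centralizer_le_relIndex_center z U fun u hu g => hzeq _ (hUW u hu g)
      _ ≤ D.relIndex U := relIndex_le_of_le_left hDc
          (isFiniteRelIndex_of_finiteIndex).relIndex_ne_zero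
      _ ≤ D.relIndex (⊤ : Subgroup G).squares := relIndex_le_of_le_right hUsqtop
          (isFiniteRelIndex_of_finiteIndex).relIndex_ne_zero

/-! ### A-subgroups and the construction of C. -/

variable {A : Type*} [Group A] [MulDistribMulAction A G]

theorem IsASubgroup.of_characteristic (N : Subgroup G) [hN : N.Characteristic] :
    IsASubgroup A N := fun a h hh => by
  rw [← hN.fixed (MulDistribMulAction.toMulEquiv G a)] at hh
  exact hh

theorem IsASubgroup.sup {H K : Subgroup G} (hH : IsASubgroup A H) (hK : IsASubgroup A K) :
    IsASubgroup A (H ⊔ K) := fun a => by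
  change H ⊔ K ≤ (H ⊔ K).comap (MulDistribMulAction.toMonoidHom G a)
  exact sup_le (fun h hh => mem_sup_left (hH a h hh)) (fun h hh => mem_sup_right (hK a h hh))

theorem IsASubgroup.centralizer {H : Subgroup G} (hH : IsASubgroup A H) :
    IsASubgroup A (Subgroup.centralizer (H : Set G)) := fun a c hc => by
  rw [mem_centralizer_iff] at hc ⊢
  intro h hh
  have := congrArg (a • ·) (hc _ (hH a⁻¹ h hh))
  simpa [smul_mul'] using this

theorem IsASubgroup.comap_mk {N : Subgroup G} [N.Normal] [MulAction.QuotientAction A N]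
    {K : Subgroup (G ⧸ N)} (hK : IsASubgroup A K) :
    IsASubgroup A (K.comap (QuotientGroup.mk' N)) := fun a h hh => hK a (QuotientGroup.mk' N h) hh

/-- A nontrivial `A`-subgroup of a finite `p`-group has a nontrivial fixed point of the
`p`-group `A`. -/
theorem IsPGroup.exists_mem_smul_eq_of_isASubgroup [Finite G] {p : ℕ} [Fact p.Prime]
    (hG : IsPGroup p G) (hA : IsPGroup p A) {X : Subgroup G} (hX : IsASubgroup A X) (hne : X ≠ ⊥) :
    ∃ v ∈ X, v ≠ 1 ∧ ∀ a : A, a • v = v := by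
  let _ : MulAction A X :=
    { smul := fun a x => ⟨a • (x : G), hX a x x.2⟩
      one_smul := fun x => Subtype.ext (one_smul A (x : G))
      mul_smul := fun a b x => Subtype.ext (mul_smul a b (x : G)) }
  have hsmul : ∀ (a : A) (x : X), ((a • x : X) : G) = a • (x : G) := fun _ _ => rfl
  have hdvd : p ∣ Nat.card X := (hG.to_subgroup X).card_eq_or_dvd.resolve_left fun h =>
    hne (X.card_eq_one.1 h)
  obtain ⟨b, hb, hne'⟩ := hA.exists_fixed_point_of_prime_dvd_card_of_fixed_point X hdvd
    (a := 1) (fun a => Subtype.ext (by rw [hsmul]; exact smul_one a))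
  exact ⟨b, b.2, fun h => hne' (Subtype.ext h.symm), fun a => by rw [← hsmul, hb a]⟩

/-- If `γ₃(G)` is not contained in the subgroup generated by the squares of `γ₂(G)`, then some
proper `A`-subgroup `C` containing `γ₂(G)` satisfies `d(C / γ₃(G)) ≥ d(G)`. -/
theorem IsPGroup.exists_isASubgroup_index_squares_le [Finite G] (hG : IsPGroup 2 G)
    (hA : IsPGroup 2 A)
    (h : ¬ Subgroup.lowerCentralSeries (⊤ : Subgroup G) 2 ≤
      (Subgroup.lowerCentralSeries (⊤ : Subgroup G) 1).squares) :
    ∃ C : Subgroup G, IsASubgroup A C ∧ C < ⊤ ∧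
      Subgroup.lowerCentralSeries (⊤ : Subgroup G) 1 ≤ C ∧ (⊤ : Subgroup G).squares.index ≤
        (C.squares ⊔ Subgroup.lowerCentralSeries (⊤ : Subgroup G) 2).relIndex C := by
  have : Fact (Nat.Prime 2) := ⟨Nat.prime_two⟩
  have : Group.IsNilpotent G := hG.isNilpotent
  set U := Subgroup.lowerCentralSeries (⊤ : Subgroup G) 1 with hUdef
  set W := Subgroup.lowerCentralSeries (⊤ : Subgroup G) 2 with hWdef
  have hWU : W ≤ U := Subgroup.lowerCentralSeries_antitone ⊤ one_le_two
  -- U²γ₄(G) does not contain W, by the Nakayama-type lemma; enlarge it to a maximal such N.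
  obtain ⟨N, hDN, hmax⟩ := (Set.toFinite {N : Subgroup G |
    N.Normal ∧ IsASubgroup A N ∧ N ≤ U ∧ ¬ W ≤ N}).exists_le_maximal
    (a := U.squares ⊔ Subgroup.lowerCentralSeries (⊤ : Subgroup G) 3)
    ⟨inferInstance, (IsASubgroup.of_characteristic _).sup (IsASubgroup.of_characteristic _),
      sup_le U.squares_le_self (Subgroup.lowerCentralSeries_antitone ⊤ (by norm_num)),
      fun hle => h (le_of_le_sup_commutator_top hle)⟩
  obtain ⟨hNn, hNA, hNU, hWN⟩ := hmax.prop
  have : MulAction.QuotientAction A N := ⟨fun a x y hxy => by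
    have := hNA a _ hxy
    rwa [smul_mul', smul_inv'] at this⟩
  set f := QuotientGroup.mk' N with hf
  have hfs : Function.Surjective f := QuotientGroup.mk'_surjective N
  have hker : f.ker = N := QuotientGroup.ker_mk' N
  have hlcs : ∀ n, (Subgroup.lowerCentralSeries (⊤ : Subgroup G) n).map f =
      Subgroup.lowerCentralSeries (⊤ : Subgroup (G ⧸ N)) n := fun n => by
    rw [map_lowerCentralSeries, map_top_of_surjective f hfs]
  have hbot : ∀ K : Subgroup G, K ≤ N → K.map f = ⊥ := fun K hK => by
    rwa [Subgroup.map_eq_bot_iff, hker]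
  have h2 : (Subgroup.lowerCentralSeries (⊤ : Subgroup (G ⧸ N)) 1).squares = ⊥ := by
    rw [← hlcs, ← map_squares, hbot _ (le_sup_left.trans hDN)]
  have h4 : Subgroup.lowerCentralSeries (⊤ : Subgroup (G ⧸ N)) 3 = ⊥ := by
    rw [← hlcs, hbot _ (le_sup_right.trans hDN)]
  have hne : Subgroup.lowerCentralSeries (⊤ : Subgroup (G ⧸ N)) 2 ≠ ⊥ := by
    rwa [← hlcs, Ne, Subgroup.map_eq_bot_iff, hker]
  obtain ⟨v, hv, hv1, hvA⟩ := (hG.to_quotient N).exists_mem_smul_eq_of_isASubgroup hA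
    (IsASubgroup.of_characteristic (A := A) (Subgroup.lowerCentralSeries (⊤ : Subgroup (G ⧸ N)) 2))
    hne
  have hvc : v ∈ center (G ⧸ N) := commutator_top_right_eq_bot_iff_le_center.1 h4 hv
  -- Since v is central and fixed by A, the preimage of ⟨v⟩ is a normal A-subgroup strictly above N;
  -- by maximality it contains W.
  have hWv : Subgroup.lowerCentralSeries (⊤ : Subgroup (G ⧸ N)) 2 ≤ zpowers v := by
    by_contra hcon
    have hzn : (zpowers v).Normal := ⟨fun x hx g => by
      rw [mem_center_iff.1 ((zpowers_le.2 hvc) hx) g, mul_inv_cancel_right]; exact hx⟩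
    have hzA : IsASubgroup A (zpowers v) := by
      rintro a _ ⟨k, rfl⟩
      exact ⟨k, by simp only [smul_zpow', hvA]⟩
    have hle : (zpowers v).comap f ≤ N := by
      refine hmax.le_of_ge (y := (zpowers v).comap f) ⟨inferInstance, hzA.comap_mk, ?_, ?_⟩ ?_
      · have : zpowers v ≤ U.map f := by
          rw [hlcs, zpowers_le]
          exact Subgroup.lowerCentralSeries_antitone ⊤ one_le_two hv
        refine (comap_mono this).trans ?_
        rw [comap_map_eq, hker]
        exact sup_le le_rfl hNU
      · rwa [← map_le_iff_le_comap, hlcs]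
      · exact hker.ge.trans (ker_le_comap f _)
    have := (map_mono (f := f) hle)
    rw [map_comap_eq_self_of_surjective hfs, hbot N le_rfl, zpowers_le, mem_bot] at this
    exact hv1 this
  have h3 : Nat.card (Subgroup.lowerCentralSeries (⊤ : Subgroup (G ⧸ N)) 2) = 2 := by
    rw [le_antisymm hWv (zpowers_le.2 hv), Nat.card_zpowers]
    refine orderOf_eq_prime ?_ hv1
    rw [← mem_bot, ← h2]
    exact sq_mem_squares (Subgroup.lowerCentralSeries_antitone ⊤ one_le_two hv)
  obtain ⟨hlt, hUC, hidx⟩ := index_squares_top_le_relIndex_centralizer h2 h3 h4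
  set C := Subgroup.centralizer (Subgroup.lowerCentralSeries (⊤ : Subgroup (G ⧸ N)) 1 : Set (G ⧸ N))
  refine ⟨C.comap f, (IsASubgroup.of_characteristic _).centralizer.comap_mk, ?_, ?_, ?_⟩
  · refine lt_top_iff_ne_top.2 fun htop => hlt.ne ?_
    rw [← map_comap_eq_self_of_surjective hfs C, htop, map_top_of_surjective f hfs]
  · rwa [← map_le_iff_le_comap, hlcs]
  · have hN : N ≤ (⊤ : Subgroup G).squares := hNU.trans lowerCentralSeries_one_le_squares_top
    rw [← hlcs 2, ← map_top_of_surjective f hfs, ← map_squares, ← index_comap_of_surjective _ hfs,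
      comap_map_eq, hker, sup_eq_left.2 hN] at hidx
    refine hidx.trans ?_
    -- Pulled back to G, the index is that of C²WN in C; dropping N can only increase it.
    nth_rewrite 2 [← map_comap_eq_self_of_surjective hfs C]
    rw [← relIndex_comap, comap_squares_sup_map hfs]
    exact relIndex_le_of_le_left le_sup_left
      (isFiniteRelIndex_of_finiteIndex).relIndex_ne_zero

end

/-- The terms `γ₂(G)` and `γ₃(G)` of the lower central series (`γ₁(G) = G`) are those of index
`1` and `2` in Mathlib's indexing, which starts at `0`. -/
theorem mainTheorem4 (G A : Type*) [Group G] [Finite G] [Group A] [Finite A]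
    [MulDistribMulAction A G] (hG : IsPGroup 2 G) (hA : IsPGroup 2 A) :
    List.TFAE
      [IsDMaximal A G,
       IsDMaximal A (G ⧸ Subgroup.lowerCentralSeries (⊤ : Subgroup G) 2),
       ∀ H : Subgroup G, IsASubgroup A H → H < ⊤ →
         Subgroup.lowerCentralSeries (⊤ : Subgroup G) 1 ≤ H → Group.rank H < Group.rank G] := by
  set U := Subgroup.lowerCentralSeries (⊤ : Subgroup G) 1 with hU
  set W := Subgroup.lowerCentralSeries (⊤ : Subgroup G) 2 with hW
  have hWU : W ≤ U := Subgroup.lowerCentralSeries_antitone ⊤ one_le_two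
  have hUsq : U ≤ (⊤ : Subgroup G).squares := Subgroup.lowerCentralSeries_one_le_squares_top
  have hs := QuotientGroup.mk'_surjective W
  have hrank : Group.rank (G ⧸ W) = Group.rank G := hG.rank_quotient_eq_rank W (hWU.trans hUsq)
  have hpow : ∀ {m n : ℕ}, 2 ^ m < 2 ^ n ↔ m < n := Nat.pow_lt_pow_iff_right one_lt_two
  -- the rank of the image of `H` in the quotient by `W`
  have hquot : ∀ H : Subgroup G, W ≤ H → IsASubgroup A H → H < ⊤ → IsDMaximal A (G ⧸ W) →
      (H.squares ⊔ W).relIndex H < 2 ^ Group.rank G := by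
    intro H hWH hHA hH hd
    have hcm : (H.map (QuotientGroup.mk' W)).comap (QuotientGroup.mk' W) = H := by
      rw [Subgroup.comap_map_eq, QuotientGroup.ker_mk', sup_eq_left.2 hWH]
    have h1 := hd (H.map (QuotientGroup.mk' W)) (by
      rintro a _ ⟨h, hh, rfl⟩
      exact ⟨a • h, hHA a h hh, rfl⟩) (lt_top_iff_ne_top.2 fun htop => hH.ne (by
        rw [← hcm, htop, Subgroup.comap_top]))
    rw [hrank, ← hpow, hG.two_pow_rank_map_mk, hcm] at h1
    exact h1
  tfae_have 1 → 2 := by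
    intro hd K hKA hK
    have hKA' : IsASubgroup A (K.comap (QuotientGroup.mk' W)) := hKA.comap_mk
    have h1 := hd _ hKA' (lt_top_iff_ne_top.2 fun htop => hK.ne (by
      rw [← Subgroup.map_comap_eq_self_of_surjective hs K, htop,
        Subgroup.map_top_of_surjective _ hs]))
    rw [hrank, ← hpow, hG.two_pow_rank_map_mk]
    rw [← hpow, hG.two_pow_rank_subgroup] at h1
    exact (Subgroup.relIndex_le_of_le_left le_sup_left
      (Subgroup.isFiniteRelIndex_of_finiteIndex).relIndex_ne_zero).trans_lt h1
  tfae_have 2 → 3 := by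
    intro hd H hHA hH hUH
    have hWsq : W ≤ U.squares := by
      by_contra h
      obtain ⟨C, hCA, hC, hUC, hle⟩ := hG.exists_isASubgroup_index_squares_le hA h
      rw [← hG.two_pow_rank] at hle
      exact absurd (hquot C (hWU.trans hUC) hCA hC hd) hle.not_gt
    have h1 := hquot H (hWU.trans hUH) hHA hH hd
    rw [sup_eq_left.2 (hWsq.trans (Subgroup.squares_mono hUH)), ← hG.two_pow_rank_subgroup] at h1
    exact hpow.1 h1
  tfae_have 3 → 1 := by
    intro h3 H hHA hH
    have hWsq : W ≤ U.squares := by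
      by_contra h
      obtain ⟨C, hCA, hC, hUC, hle⟩ := hG.exists_isASubgroup_index_squares_le hA h
      have h1 := h3 C hCA hC hUC
      rw [← hpow, hG.two_pow_rank, hG.two_pow_rank_subgroup] at h1
      exact absurd (hle.trans (Subgroup.relIndex_le_of_le_left le_sup_left
        (Subgroup.isFiniteRelIndex_of_finiteIndex).relIndex_ne_zero)) h1.not_ge
    refine (hG.rank_le_rank_sup U le_rfl hWsq H).trans_lt
      (h3 _ (hHA.sup (IsASubgroup.of_characteristic U)) ?_ le_sup_right)
    refine lt_top_iff_ne_top.2 fun htop => hH.ne (frattini_nongenerating (top_le_iff.1 ?_))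
    rw [← htop]
    exact sup_le_sup_left (hUsq.trans hG.squares_top_le_frattini) H
  tfae_finish
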